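/- Let $d\ge 0$ be an integer, $p\in(0,2]$, $w>0$, and let $W^\circ\in\mathbb{R}^d$ be a weight vector with all entries positive. Let $D_{W^\circ}(u,v)=\big(\sum_{i=1}^d |w_i^\circ u_i-w_i^\circ v_i|^p\big)^{1/p}$ be the weighted $l_p$ distance on $\mathbb{R}^d$. Let $\mu$ be a $p$-stable probability law on $\mathbb{R}$: $\mu\neq\delta_0$, and for all $n$ and all real $v_1,\dots,v_n$, if $X,X_1,\dots,X_n$ are independent with law $\mu$, then $\sum_i v_iX_i$ and $(\sum_i|v_i|^p)^{1/p}X$ have the same law. Let $F_p$ be the probability density function of $|X|$ for $X\sim\mu$, and for $r>0$ put $$P_{l_p}(r)=\int_0^w \frac1r F_p\Big(\frac tr\Big)\Big(1-\frac tw\Big)\,dt .$$ Let $c\ge 2$ be an integer, let $0<r_{\min}\le r_{\max}$ (the smallest and the largest possible distances between two points under $W^\circ$) and let $\rho\ge r_{\max}/r_{\min}$ be real. Let $a\in\mathbb{R}^d$ have independent entries with law $\mu$, let $b^*$ be independent of $a$ and uniform on $[0,c^{\lceil\log_c\rho\rceil}w]$, and for $u\in\mathbb{R}^d$ and $l>0$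 define $$h(u)=\Big\lfloor\frac{a\cdot(W^\circ\circ u)+b^*}{w}\Big\rfloor,\qquad h^l(u)=\Big\lfloor\frac{h(u)}{l}\Big\rfloor,$$ where $\circ$ is the element-wise product. A random function $g$ on $\mathbb{R}^d$ is called $(R_1,R_2,P_1,P_2)$-sensitive if for all $u,v\in\mathbb{R}^d$: $D_{W^\circ}(u,v)\le R_1$ implies $\Pr[g(u)=g(v)]\ge P_1$, and $D_{W^\circ}(u,v)>R_2$ implies $\Pr[g(u)=g(v)]\le P_2$. Then for all real numbers $x,y$ with $0<x<y$: (1) $h$ is $(x,\,y,\,P_{l_p}(x),\,P_{l_p}(y))$-sensitive; (2) $h^l$ is $(xl,\,yl,\,P_{l_p}(x),\,P_{l_p}(y))$-sensitive for every $l\in\{c,c^2,\dots,c^{\lceil\log_c (r_{\max}/r_{\min})\rceil}\}$. -/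

import Mathlib

open MeasureTheory ProbabilityTheory

noncomputable section

namespace WeightedLSH

/-- A probability law `μ` on the real line is `p`-stable if for all real numbers `v₁, …, vₙ` and
independent `X, X₁, …, Xₙ` with law `μ`, the random variables `∑ vᵢ Xᵢ` and `(∑ |vᵢ|^p)^(1/p) X`
have the same law. The point mass at `0`, which satisfies this for every `p` trivially, is
excluded. No normalization of the scale is imposed (for `p = 2` these are the centred normal laws
with nonzero variance, for `p = 1` the centred Cauchy laws). -/
structure IsPStable (p : ℝ) (μ : Measure ℝ) : Prop where
  isProbabilityMeasure : IsProbabilityMeasure μ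
  nondegenerate : μ ≠ Measure.dirac 0
  stable : ∀ (n : ℕ) (v : Fin n → ℝ),
    (Measure.pi fun _ : Fin n => μ).map (fun X => ∑ i, v i * X i) =
      μ.map (fun X => (∑ i, |v i| ^ p) ^ (1 / p) * X)

/-- The `l_p` distance on `ℝ^d`. -/
def lpDist {d : ℕ} (p : ℝ) (x y : Fin d → ℝ) : ℝ :=
  (∑ i, |x i - y i| ^ p) ^ (1 / p)

/-- The weighted `l_p` distance `D_W(x, y) = D(W ∘ x, W ∘ y)`, where `∘` is the element-wise
product (written `W * x` here, the product of functions being pointwise). -/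
def weightedLpDist {d : ℕ} (p : ℝ) (W : Fin d → ℝ) (x y : Fin d → ℝ) : ℝ :=
  lpDist p (W * x) (W * y)

/-- The ball `B(x, R) = {y | D(x, y) ≤ R}` of a distance function `D`. -/
def distBall {X : Type*} (D : X → X → ℝ) (x : X) (R : ℝ) : Set X :=
  {y | D x y ≤ R}

/-- A random hash function `h ω : X → U`, with `ω` drawn from `ν`, is `(R₁, R₂, P₁, P₂)`-sensitive
for the distance function `D` if points of `B(x, R₁)` collide with `x` with probability at least
`P₁` and points outside `B(x, R₂)` collide with `x` with probability at most `P₂`. -/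
def IsSensitive {Ω X U : Type*} [MeasurableSpace Ω] (D : X → X → ℝ) (ν : Measure Ω)
    (h : Ω → X → U) (R₁ R₂ P₁ P₂ : ℝ) : Prop :=
  ∀ x y : X,
    (y ∈ distBall D x R₁ → P₁ ≤ ν.real {ω | h ω x = h ω y}) ∧
    (y ∉ distBall D x R₂ → ν.real {ω | h ω x = h ω y} ≤ P₂)

/-- The probability density function `F_p` of the absolute value of a random variable with
law `μ`. -/
def absPDF (μ : Measure ℝ) (t : ℝ) : ℝ :=
  (pdf (fun x : ℝ => |x|) μ volume t).toReal

/-- The function `P_{l_p}(r) = ∫_0^w (1/r) F_p(t/r) (1 - t/w) dt`. -/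
def collisionProb (μ : Measure ℝ) (w r : ℝ) : ℝ :=
  ∫ t in (0 : ℝ)..w, 1 / r * absPDF μ (t / r) * (1 - t / w)

/-- The joint law of the parameters `(a, b)`: the entries of `a` are independent with law `μ`, and
`b` is independent of `a` and uniformly distributed on `[0, M]`. -/
def paramLaw (d : ℕ) (μ : Measure ℝ) (M : ℝ) : Measure ((Fin d → ℝ) × ℝ) :=
  (Measure.pi fun _ : Fin d => μ).prod (volume[|Set.Icc 0 M])

/-- The hash function `h(x) = ⌊(a · (W ∘ x) + b) / w⌋` with parameters `ω = (a, b)`. -/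
def weightedHash {d : ℕ} (W : Fin d → ℝ) (w : ℝ) (ω : (Fin d → ℝ) × ℝ) (x : Fin d → ℝ) : ℤ :=
  ⌊(ω.1 ⬝ᵥ (W * x) + ω.2) / w⌋

/-- The level-`l` hash function `h^l(x) = ⌊h(x) / l⌋`. -/
def levelHash {d : ℕ} (W : Fin d → ℝ) (w l : ℝ) (ω : (Fin d → ℝ) × ℝ) (x : Fin d → ℝ) : ℤ :=
  ⌊(weightedHash W w ω x : ℝ) / l⌋

/-- The integer `⌈log_c s⌉` (used for `c ≥ 2` and `s ≥ 1`, where it is nonnegative). -/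
def levelCount (c : ℕ) (s : ℝ) : ℕ :=
  ⌈Real.logb c s⌉₊

end WeightedLSH

end

open scoped Real NNReal ENNReal

namespace WeightedLSH

/-! Given `a`, two points collide when a uniformly shifted grid of width `w` does not separate their
projections. If the shift runs over whole periods, this has probability `max 0 (1 - |δ| / w)`, where
`δ` is the difference of the projections (`cond_real_floor_eq`). By stability `δ` is distributed as
`D * X`, with `D` the weighted distance and `X ∼ μ`, so the collision probability is the mean of
`max 0 (1 - |D * X| / w)`, which is antitone in `D` (`integral_triangle_anti`). For `r > 0` this
mean at `r` is `collisionProb μ w r`, because `μ` has a density. Nested floors collapse, so level `l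
= c ^ j` is the same hash with width `w * l`, and the shift interval is still a whole number of its
periods. The density comes from Fourier analysis: stability makes the characteristic function decay
exponentially in `|t| ^ p`, so it is integrable and `μ` gives a ball of radius `δ` mass `O(δ)`. -/

/-! ### Absolute continuity from an integrable characteristic function -/

theorem measure_closedBall_le_of_integrable_charFun {μ : Measure ℝ} [IsProbabilityMeasure μ]
    (hφ : Integrable (charFun μ)) (a : ℝ) {δ : ℝ} (hδ : 0 < δ) :
    μ (Metric.closedBall a δ) ≤
      ENNReal.ofReal ((Real.exp (1 / 2) * ((√(2 * π))⁻¹ * ∫ t, ‖charFun μ t‖)) * δ) := by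
  -- The Gaussian bump of width `δ` at `a` is at least `exp (-1/2)` on the ball and is the Fourier
  -- transform of `N(0, δ⁻²)`, whose density is at most `δ / √(2π)`. Fubini moves the transform onto
  -- `μ`.
  set v : ℝ≥0 := ⟨(δ⁻¹) ^ 2, by positivity⟩
  have hv0 : v ≠ 0 := by
    intro h
    have h' : (δ⁻¹) ^ 2 = 0 := congrArg NNReal.toReal h
    exact (pow_pos (inv_pos.2 hδ) 2).ne' h'
  have hvδ : (v : ℝ) = (δ⁻¹) ^ 2 := rfl
  set N := gaussianReal 0 v
  have hgauss : ∀ x : ℝ, ((Real.exp (-(v * (x - a) ^ 2 / 2)) : ℝ) : ℂ) =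
      ∫ t, Complex.exp (t * x * Complex.I) * Complex.exp (-(a * t * Complex.I)) ∂N := by
    intro x
    have h := charFun_gaussianReal (μ := 0) (v := v) (x - a)
    rw [charFun_apply_real] at h
    push_cast at h ⊢
    rw [show (-(v * (x - a) ^ 2 / 2) : ℂ) = (x - a) * (0 : ℝ) * Complex.I - v * (x - a) ^ 2 / 2 by
      push_cast; ring]
    push_cast
    rw [← h]
    refine integral_congr_ae (.of_forall fun t => ?_)
    simp only [← Complex.exp_add]
    congr 1
    ring
  have hswap : ((∫ x, Real.exp (-(v * (x - a) ^ 2 / 2)) ∂μ : ℝ) : ℂ) =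
      ∫ t, charFun μ t * Complex.exp (-(a * t * Complex.I)) ∂N := by
    rw [← integral_complex_ofReal]
    simp_rw [hgauss]
    rw [integral_integral_swap]
    · refine integral_congr_ae (.of_forall fun t => ?_)
      simp only [charFun_apply_real]
      rw [integral_mul_const]
    · refine Integrable.of_bound (C := 1) (Continuous.aestronglyMeasurable (by fun_prop)) ?_
      refine .of_forall fun z => ?_
      simp only [Function.uncurry, norm_mul, Complex.norm_exp]
      simp
  have hbound : ∫ x, Real.exp (-(v * (x - a) ^ 2 / 2)) ∂μ ≤
      (√(2 * π))⁻¹ * (∫ t, ‖charFun μ t‖) * δ := by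
    have h0 : 0 ≤ ∫ x, Real.exp (-(v * (x - a) ^ 2 / 2)) ∂μ :=
      integral_nonneg fun x => (Real.exp_pos _).le
    have h1 : ∫ x, Real.exp (-(v * (x - a) ^ 2 / 2)) ∂μ ≤ ∫ t, ‖charFun μ t‖ ∂N := by
      calc _ = ‖((∫ x, Real.exp (-(v * (x - a) ^ 2 / 2)) ∂μ : ℝ) : ℂ)‖ := by
            rw [Complex.norm_real, Real.norm_of_nonneg h0]
        _ ≤ ∫ t, ‖charFun μ t * Complex.exp (-(a * t * Complex.I))‖ ∂N := by
            rw [hswap]; exact norm_integral_le_integral_norm _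
        _ = _ := by
            refine integral_congr_ae (.of_forall fun t => ?_)
            simp [Complex.norm_exp]
    refine h1.trans ?_
    rw [integral_gaussianReal_eq_integral_smul hv0, mul_comm, ← mul_assoc, ← integral_const_mul]
    refine integral_mono_of_nonneg
      (.of_forall fun t => mul_nonneg (gaussianPDFReal_nonneg _ _ _) (norm_nonneg _))
      (hφ.norm.const_mul _) (.of_forall fun t => ?_)
    simp only [smul_eq_mul]
    gcongr
    rw [gaussianPDFReal_def]
    have hsq : (√(2 * π * v))⁻¹ = δ * (√(2 * π))⁻¹ := by
      rw [hvδ, Real.sqrt_mul (by positivity), Real.sqrt_sq (by positivity), mul_inv, inv_inv,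
        mul_comm]
    simp only [hsq]
    refine mul_le_of_le_one_right (by positivity) ?_
    rw [Real.exp_le_one_iff, neg_div]
    have : (0 : ℝ) ≤ (t - 0) ^ 2 / (2 * v) := by positivity
    linarith
  have hle : μ.real (Metric.closedBall a δ) ≤
      Real.exp (1 / 2) * ∫ x, Real.exp (-(v * (x - a) ^ 2 / 2)) ∂μ := by
    rw [← integral_const_mul, ← integral_indicator_one Metric.isClosed_closedBall.measurableSet]
    refine integral_mono_of_nonneg
      (.of_forall fun x => Set.indicator_nonneg (fun _ _ => zero_le_one) _) ?_
      (.of_forall fun x => ?_)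
    · refine Integrable.const_mul ?_ _
      refine Integrable.of_bound (C := 1) (Continuous.aestronglyMeasurable (by fun_prop))
        (.of_forall fun x => ?_)
      rw [Real.norm_of_nonneg (Real.exp_pos _).le, Real.exp_le_one_iff]
      have : (0 : ℝ) ≤ v * (x - a) ^ 2 / 2 := by positivity
      linarith
    · by_cases hx : x ∈ Metric.closedBall a δ
      swap
      · rw [Set.indicator_of_notMem hx]
        positivity
      rw [Set.indicator_of_mem hx]
      simp only [Pi.one_apply, ← Real.exp_add]
      refine Real.one_le_exp ?_
      rw [Metric.mem_closedBall, Real.dist_eq] at hx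
      have h2 : (v : ℝ) * (x - a) ^ 2 ≤ 1 := by
        rw [hvδ, ← mul_pow, sq_le_one_iff_abs_le_one, abs_mul, abs_of_pos (inv_pos.2 hδ)]
        calc δ⁻¹ * |x - a| ≤ δ⁻¹ * δ := by gcongr
          _ = 1 := inv_mul_cancel₀ hδ.ne'
      linarith
  rw [← ofReal_measureReal]
  refine ENNReal.ofReal_le_ofReal (hle.trans ?_)
  calc _ ≤ Real.exp (1 / 2) * ((√(2 * π))⁻¹ * (∫ t, ‖charFun μ t‖) * δ) := by gcongr
    _ = _ := by ring

/-- Lebesgue measure on the line is one-dimensional Hausdorff measure, which dominates any measure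
bounded by the diameter; `μ / C` is one, as a set of diameter less than `q` lies in a ball of radius
`q`. -/
theorem absolutelyContinuous_of_measure_closedBall_le {μ : Measure ℝ} {C : ℝ}
    (h : ∀ (a δ : ℝ), 0 < δ → μ (Metric.closedBall a δ) ≤ ENNReal.ofReal (C * δ)) :
    μ ≪ volume := by
  wlog hC : 0 < C generalizing C
  · refine this (C := 1) (fun a δ hδ => (h a δ hδ).trans (ENNReal.ofReal_le_ofReal ?_)) one_pos
    nlinarith
  have key : (ENNReal.ofReal C)⁻¹ • μ ≤ (volume : Measure ℝ) := by
    rw [← hausdorffMeasure_real]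
    refine Measure.le_hausdorffMeasure 1 _ 1 one_pos fun s hs => ?_
    rw [ENNReal.rpow_one]
    rcases s.eq_empty_or_nonempty with rfl | ⟨a, ha⟩
    · simp
    refine le_of_forall_gt fun r hr => ?_
    obtain ⟨q, hq, hqr⟩ := exists_between hr
    have hq_top : q ≠ ∞ := hqr.ne_top
    have hq0 : 0 < q.toReal := ENNReal.toReal_pos (pos_of_gt hq).ne' hq_top
    refine lt_of_le_of_lt ?_ hqr
    have hsub : s ⊆ Metric.closedBall a q.toReal := fun y hy => by
      rw [Metric.mem_closedBall, dist_edist]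
      exact ENNReal.toReal_mono hq_top ((Metric.edist_le_ediam_of_mem hy ha).trans hq.le)
    rw [Measure.smul_apply, smul_eq_mul]
    calc _ ≤ (ENNReal.ofReal C)⁻¹ * ENNReal.ofReal (C * q.toReal) := by
          gcongr
          exact (measure_mono hsub).trans (h a _ hq0)
      _ = q := by
          rw [ENNReal.ofReal_mul hC.le, ENNReal.ofReal_toReal hq_top, ← mul_assoc,
            ENNReal.inv_mul_cancel (by simpa using hC) ENNReal.ofReal_ne_top, one_mul]
  intro s hs
  have := le_antisymm ((key s).trans hs.le) bot_le
  simpa using this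

theorem integrable_comp_abs_of_integrableOn {f : ℝ → ℝ} (hf : IntegrableOn f (Set.Ioi 0)) :
    Integrable fun t => f |t| := by
  have hpos : IntegrableOn (fun t => f |t|) (Set.Ioi 0) :=
    hf.congr_fun (fun t ht => by rw [abs_of_pos ht]) measurableSet_Ioi
  have hneg : IntegrableOn (fun t => f |t|) (Set.Iic 0) := by
    rw [← Measure.map_neg_eq_self (volume : Measure ℝ)]
    have m : MeasurableEmbedding fun x : ℝ => -x := (Homeomorph.neg ℝ).measurableEmbedding
    rw [m.integrableOn_map_iff]
    simp only [Function.comp_def, abs_neg, Set.neg_preimage, Set.neg_Iic, neg_zero]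
    exact Iff.mpr integrableOn_Ici_iff_integrableOn_Ioi hpos
  rw [← integrableOn_univ, ← Set.Iic_union_Ioi (a := (0 : ℝ))]
  exact hneg.union hpos

/-! ### Characteristic functions of stable laws -/

theorem IsPStable.prod_charFun {p : ℝ} {μ : Measure ℝ} (hμ : IsPStable p μ) {n : ℕ}
    (v : Fin n → ℝ) (t : ℝ) :
    ∏ i, charFun μ (v i * t) = charFun μ ((∑ i, |v i| ^ p) ^ (1 / p) * t) := by
  have := hμ.isProbabilityMeasure
  have h := congrArg (fun ν => charFun ν t) (hμ.stable n v)
  rw [charFun_map_mul, charFun_apply_real, integral_map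
    (Measurable.aemeasurable (by fun_prop))
    (Continuous.aestronglyMeasurable (by fun_prop))] at h
  rw [← h]
  simp only [charFun_apply_real]
  rw [← integral_fintype_prod_eq_prod]
  refine integral_congr_ae (.of_forall fun X => ?_)
  simp only [← Complex.exp_sum]
  congr 1
  push_cast
  rw [Finset.mul_sum, Finset.sum_mul]
  exact Finset.sum_congr rfl fun i _ => by ring

theorem IsPStable.charFun_neg_eq {p : ℝ} {μ : Measure ℝ} (hμ : IsPStable p μ) (t : ℝ) :
    charFun μ (-t) = charFun μ t := by
  simpa using hμ.prod_charFun (fun _ : Fin 1 => (-1 : ℝ)) t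

theorem IsPStable.charFun_rpow_add {p : ℝ} (hp : 0 < p) {μ : Measure ℝ} (hμ : IsPStable p μ)
    {a b : ℝ} (ha : 0 ≤ a) (hb : 0 ≤ b) :
    charFun μ ((a + b) ^ (1 / p)) = charFun μ (a ^ (1 / p)) * charFun μ (b ^ (1 / p)) := by
  have h := hμ.prod_charFun ![a ^ (1 / p), b ^ (1 / p)] 1
  have e : ∀ x : ℝ, 0 ≤ x → |x ^ (1 / p)| ^ p = x := fun x hx => by
    rw [abs_of_nonneg (by positivity), ← Real.rpow_mul hx, one_div_mul_cancel hp.ne',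
      Real.rpow_one]
  simpa [-one_div, Fin.sum_univ_two, Fin.prod_univ_two, e a ha, e b hb] using h.symm

/-- Symmetry makes the characteristic function real, so its square is 1. Halving `t ^ p` exhibits
each value as such a square. -/
theorem eq_dirac_of_norm_charFun_eq_one {p : ℝ} (hp : 0 < p) {μ : Measure ℝ}
    (hμ : IsPStable p μ) (h : ∀ t, 0 ≤ t → ‖charFun μ t‖ = 1) : μ = Measure.dirac 0 := by
  have := hμ.isProbabilityMeasure
  have hsq : ∀ t, 0 ≤ t → charFun μ t * charFun μ t = 1 := fun t ht => by
    have hc : (starRingEnd ℂ) (charFun μ t) = charFun μ t := by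
      rw [← charFun_neg, hμ.charFun_neg_eq]
    calc _ = (starRingEnd ℂ) (charFun μ t) * charFun μ t := by rw [hc]
      _ = 1 := by rw [← Complex.normSq_eq_conj_mul_self, Complex.normSq_eq_norm_sq, h t ht]; simp
  have hone : ∀ t, 0 ≤ t → charFun μ t = 1 := fun t ht => by
    have h2 : 0 ≤ t ^ p / 2 := by positivity
    have := hμ.charFun_rpow_add hp h2 h2
    rw [add_halves, hsq _ (by positivity), ← Real.rpow_mul ht, mul_one_div_cancel hp.ne',
      Real.rpow_one] at this
    exact this
  refine Measure.ext_of_charFun (funext fun t => ?_)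
  rw [charFun_dirac]
  rcases le_total 0 t with ht | ht
  · simp [hone t ht]
  · rw [← hμ.charFun_neg_eq, hone _ (neg_nonneg.2 ht)]; simp

/-- In the variable `s = t ^ p` the modulus `H` is multiplicative and at most 1, hence antitone with
`H n = H 1 ^ n`. Nondegeneracy gives `H 1 < 1`, and exponential decay follows. -/
theorem IsPStable.integrable_charFun {p : ℝ} (hp : 0 < p) {μ : Measure ℝ}
    (hμ : IsPStable p μ) : Integrable (charFun μ) := by
  have := hμ.isProbabilityMeasure
  set H : ℝ → ℝ := fun s => ‖charFun μ (s ^ (1 / p))‖ with hH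
  have H_add : ∀ a b, 0 ≤ a → 0 ≤ b → H (a + b) = H a * H b := fun a b ha hb => by
    simp only [hH, hμ.charFun_rpow_add hp ha hb, norm_mul]
  have H_le : ∀ s, H s ≤ 1 := fun s => norm_charFun_le_one _
  have H_nn : ∀ s, 0 ≤ H s := fun s => norm_nonneg _
  have H_anti : ∀ a b, 0 ≤ a → a ≤ b → H b ≤ H a := fun a b ha hab => by
    have := H_add a (b - a) ha (sub_nonneg.2 hab)
    rw [add_sub_cancel] at this
    rw [this]
    exact mul_le_of_le_one_right (H_nn _) (H_le _)
  have H_zero : H 0 = 1 := by simp [hH, Real.zero_rpow (one_div_pos.2 hp).ne', -one_div]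
  have H_nat : ∀ n : ℕ, H n = H 1 ^ n := fun n => by
    induction n with
    | zero => simpa using H_zero
    | succ n ih => rw [Nat.cast_succ, H_add _ _ n.cast_nonneg zero_le_one, ih, pow_succ]
  have norm_eq : ∀ t, 0 ≤ t → ‖charFun μ t‖ = H (t ^ p) := fun t ht => by
    simp only [hH]
    rw [← Real.rpow_mul ht, mul_one_div_cancel hp.ne', Real.rpow_one]
  have H_one : H 1 < 1 := by
    refine lt_of_le_of_ne (H_le 1) fun h1 => hμ.nondegenerate ?_
    refine eq_dirac_of_norm_charFun_eq_one hp hμ fun t ht => ?_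
    rw [norm_eq t ht]
    refine le_antisymm (H_le _) ?_
    calc (1 : ℝ) = H ⌈t ^ p⌉₊ := by rw [H_nat, h1, one_pow]
      _ ≤ H (t ^ p) := H_anti _ _ (by positivity) (Nat.le_ceil _)
  -- `H 1` is not yet known to be positive, so a larger base `q` is used for logarithms.
  obtain ⟨q, hq1, hq⟩ := exists_between H_one
  have hq0 : 0 < q := (H_nn 1).trans_lt hq1
  have hlog : 0 < -Real.log q := neg_pos.2 (Real.log_neg hq0 hq)
  -- The factor `q⁻¹` pays for rounding `s` down to an integer.
  have hdecay : ∀ s, 0 ≤ s → H s ≤ q⁻¹ * Real.exp (-(-Real.log q) * s) := fun s hs => by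
    calc H s ≤ H ⌊s⌋₊ := H_anti _ _ (Nat.cast_nonneg _) (Nat.floor_le hs)
      _ = H 1 ^ ⌊s⌋₊ := H_nat _
      _ ≤ q ^ ⌊s⌋₊ := by gcongr
      _ = q ^ (⌊s⌋₊ : ℝ) := (Real.rpow_natCast _ _).symm
      _ ≤ q ^ (s - 1) := Real.rpow_le_rpow_of_exponent_ge hq0 hq.le
          (by linarith [Nat.lt_floor_add_one s])
      _ = _ := by
          rw [Real.rpow_sub_one hq0.ne', Real.rpow_def_of_pos hq0, neg_neg, div_eq_inv_mul]
  have hpos : IntegrableOn (fun t : ℝ => q⁻¹ * Real.exp (-(-Real.log q) * t ^ p)) (Set.Ioi 0) := by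
    have := integrableOn_rpow_mul_exp_neg_mul_rpow (s := 0) (by norm_num) hp hlog
    simp only [Real.rpow_zero, one_mul] at this
    exact Integrable.const_mul this _
  have hdom : Integrable (fun t : ℝ => q⁻¹ * Real.exp (-(-Real.log q) * |t| ^ p)) :=
    integrable_comp_abs_of_integrableOn hpos
  refine hdom.mono' measurable_charFun.aestronglyMeasurable (.of_forall fun t => ?_)
  have habs : ‖charFun μ t‖ = ‖charFun μ |t|‖ := by
    rcases abs_choice t with h | h <;> rw [h]
    rw [hμ.charFun_neg_eq]
  rw [habs, norm_eq _ (abs_nonneg t)]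
  exact hdecay _ (by positivity)

/-- A `p`-stable law has a density with respect to Lebesgue measure. -/
theorem IsPStable.absolutelyContinuous {p : ℝ} (hp : 0 < p) {μ : Measure ℝ}
    (hμ : IsPStable p μ) : μ ≪ volume :=
  have := hμ.isProbabilityMeasure
  absolutelyContinuous_of_measure_closedBall_le fun a _ hδ =>
    measure_closedBall_le_of_integrable_charFun (hμ.integrable_charFun hp) a hδ

/-! ### The triangular kernel -/

theorem absolutelyContinuous_map_abs {μ : Measure ℝ} (h : μ ≪ volume) :
    μ.map (fun x : ℝ => |x|) ≪ volume := by
  refine (h.map measurable_norm).trans ?_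
  refine Measure.AbsolutelyContinuous.mk fun s hs h0 => ?_
  rw [Measure.map_apply measurable_norm hs]
  refine measure_mono_null (t := s ∪ (fun x : ℝ => -x) ⁻¹' s) (fun x hx => ?_)
    (measure_union_null h0 ?_)
  · rcases abs_choice x with hx' | hx' <;> simp_all
  · simpa using h0

/-- The collision probability as an expectation of the triangular kernel. -/
theorem collisionProb_eq_integral {μ : Measure ℝ} [IsProbabilityMeasure μ] (hμ : μ ≪ volume)
    {w r : ℝ} (hw : 0 < w) (hr : 0 < r) :
    collisionProb μ w r = ∫ x, max 0 (1 - |r * x| / w) ∂μ := by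
  have hpdf : HasPDF (fun x : ℝ => |x|) μ volume :=
    ⟨measurable_norm.aemeasurable, inferInstance, absolutelyContinuous_map_abs hμ⟩
  -- The kernel as a function of `|x|`, cut off where it vanishes. It is wrong only at 0, which is
  -- not an atom of `μ`.
  set f : ℝ → ℝ := (Set.Ioc 0 (w / r)).indicator fun t => 1 - r * t / w with hf
  have hfm : Measurable f := Measurable.indicator (by fun_prop) measurableSet_Ioc
  have hzero : ∀ᵐ x ∂μ, x ≠ 0 := hμ.ae_le (Measure.ae_ne volume 0)
  have hint : ∫ x, max 0 (1 - |r * x| / w) ∂μ = ∫ x, f |x| ∂μ := by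
    refine integral_congr_ae (hzero.mono fun x hx => ?_)
    simp only [hf, abs_mul, abs_of_pos hr]
    have hx' : 0 < |x| := abs_pos.2 hx
    by_cases hxw : |x| ≤ w / r
    · rw [Set.indicator_of_mem (show |x| ∈ Set.Ioc 0 (w / r) from ⟨hx', hxw⟩), max_eq_right]
      rw [sub_nonneg, div_le_one hw, mul_comm]
      exact (le_div_iff₀ hr).1 hxw
    · rw [Set.indicator_of_notMem (fun h => hxw h.2), max_eq_left]
      rw [sub_nonpos, one_le_div hw, mul_comm]
      exact ((div_lt_iff₀ hr).1 (not_le.1 hxw)).le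
  rw [hint, ← pdf.integral_pdf_smul (μ := volume) hfm.aestronglyMeasurable]
  have hind : ∀ t, (pdf (fun x : ℝ => |x|) μ volume t).toReal • f t =
      (Set.Ioc 0 (w / r)).indicator (fun t => absPDF μ t * (1 - r * t / w)) t := fun t => by
    by_cases ht : t ∈ Set.Ioc 0 (w / r) <;> simp [hf, ht, absPDF]
  simp_rw [hind]
  rw [integral_indicator measurableSet_Ioc, ← intervalIntegral.integral_of_le (by positivity)]
  have hscale := intervalIntegral.integral_comp_div (a := 0) (b := w)
    (fun t => absPDF μ t * (1 - r * t / w)) hr.ne'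
  rw [zero_div] at hscale
  rw [collisionProb, ← inv_mul_cancel_left₀ hr.ne' (∫ t in (0 : ℝ)..w / r, _), ← smul_eq_mul r,
    ← hscale, ← intervalIntegral.integral_const_mul]
  refine intervalIntegral.integral_congr fun t _ => ?_
  rw [mul_div_cancel₀ t hr.ne', one_div, mul_assoc]

theorem integrable_triangle {μ : Measure ℝ} [IsProbabilityMeasure μ] {w : ℝ} (hw : 0 < w)
    (r : ℝ) : Integrable (fun x => max 0 (1 - |r * x| / w)) μ := by
  refine Integrable.of_bound (C := 1) (Continuous.aestronglyMeasurable (by fun_prop))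
    (.of_forall fun x => ?_)
  rw [Real.norm_of_nonneg (le_max_left _ _)]
  exact max_le zero_le_one (by have : 0 ≤ |r * x| / w := by positivity
                               linarith)

theorem integral_triangle_anti {μ : Measure ℝ} [IsProbabilityMeasure μ] {w : ℝ} (hw : 0 < w)
    {r r' : ℝ} (hr : 0 ≤ r) (hrr' : r ≤ r') :
    ∫ x, max 0 (1 - |r' * x| / w) ∂μ ≤ ∫ x, max 0 (1 - |r * x| / w) ∂μ := by
  refine integral_mono (integrable_triangle hw _) (integrable_triangle hw _) fun x => ?_
  simp only [abs_mul, abs_of_nonneg hr, abs_of_nonneg (hr.trans hrr')]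
  gcongr

/-! ### Randomly shifted grids -/

theorem measurableSet_floor_eq {α : Type*} [MeasurableSpace α] {f g : α → ℝ} (hf : Measurable f)
    (hg : Measurable g) : MeasurableSet {x | ⌊f x⌋ = ⌊g x⌋} :=
  measurableSet_eq_fun (Int.measurable_floor.comp hf) (Int.measurable_floor.comp hg)

/-- The offsets in one period for which two points at signed distance `δ` share a bucket. -/
theorem Ico_inter_floor_eq {w : ℝ} (hw : 0 < w) (δ : ℝ) :
    Set.Ico 0 w ∩ {x | ⌊x / w⌋ = ⌊(x + δ) / w⌋} = Set.Ico (max 0 (-δ)) (min w (w - δ)) := by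
  ext x
  simp only [Set.mem_inter_iff, Set.mem_Ico, Set.mem_ofPred_eq, max_le_iff, lt_min_iff]
  constructor
  · rintro ⟨⟨h0, h1⟩, h⟩
    rw [Int.floor_eq_zero_iff.2 ⟨by positivity, (div_lt_one hw).2 h1⟩, eq_comm,
      Int.floor_eq_zero_iff, Set.mem_Ico, div_lt_one hw, le_div_iff₀ hw] at h
    refine ⟨⟨h0, ?_⟩, h1, ?_⟩ <;> linarith
  · rintro ⟨⟨h0, h1⟩, h2, h3⟩
    refine ⟨⟨h0, h2⟩, ?_⟩
    rw [Int.floor_eq_zero_iff.2 ⟨by positivity, (div_lt_one hw).2 h2⟩, eq_comm,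
      Int.floor_eq_zero_iff, Set.mem_Ico, div_lt_one hw, le_div_iff₀ hw]
    constructor <;> linarith

theorem integral_floor_eq_period {w : ℝ} (hw : 0 < w) (δ : ℝ) :
    ∫ x in (0 : ℝ)..w, {x | ⌊x / w⌋ = ⌊(x + δ) / w⌋}.indicator (1 : ℝ → ℝ) x =
      max 0 (w - |δ|) := by
  have hm : MeasurableSet {x | ⌊x / w⌋ = ⌊(x + δ) / w⌋} :=
    measurableSet_floor_eq (by fun_prop) (by fun_prop)
  rw [intervalIntegral.integral_of_le hw.le, ← integral_Ico_eq_integral_Ioc,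
    integral_indicator_one hm, measureReal_restrict_apply hm, Set.inter_comm,
    Ico_inter_floor_eq hw, Measure.real, Real.volume_Ico, ENNReal.toReal_ofReal', max_comm]
  congr 1
  rcases le_total 0 δ with h | h
  · rw [min_eq_right (by linarith), max_eq_left (by linarith), abs_of_nonneg h, sub_zero]
  · rw [min_eq_left (by linarith), max_eq_right (by linarith), abs_of_nonpos h]

/-- Collision probability of a randomly shifted grid of width `w`, the shift being uniform over a
whole number of periods. -/
theorem cond_real_floor_eq {w : ℝ} (hw : 0 < w) {N : ℕ} (hN : N ≠ 0) (s t : ℝ) :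
    (volume[|Set.Icc 0 (N * w)]).real {b | ⌊(s + b) / w⌋ = ⌊(t + b) / w⌋} =
      max 0 (1 - |s - t| / w) := by
  have hNw : 0 < (N : ℝ) * w := by positivity
  have hm : MeasurableSet {b | ⌊(s + b) / w⌋ = ⌊(t + b) / w⌋} :=
    measurableSet_floor_eq (by fun_prop) (by fun_prop)
  set f : ℝ → ℝ := {b | ⌊(s + b) / w⌋ = ⌊(t + b) / w⌋}.indicator 1 with hf
  have hper : Function.Periodic f w := fun b => by
    have e : ∀ a : ℝ, ⌊(a + (b + w)) / w⌋ = ⌊(a + b) / w⌋ + 1 := fun a => by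
      rw [← add_assoc, add_div _ w, div_self hw.ne', Int.floor_add_one]
    simp only [hf, Set.indicator_apply, Set.mem_ofPred_eq, e, add_left_inj, Pi.one_apply]
  have hint : ∀ a b, IntervalIntegrable f volume a b := fun a b => by
    refine (intervalIntegrable_const (c := (1 : ℝ))).mono_fun
      (measurable_one.indicator hm).aestronglyMeasurable (.of_forall fun x => ?_)
    simp only [hf, Set.indicator_apply]
    split_ifs <;> simp
  have h1 : ∫ b in (0 : ℝ)..w, f b = max 0 (w - |s - t|) := by
    -- Periodicity allows starting the period at `-s`, which moves the first point to the origin and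
    -- the second to `t - s`.
    have := hper.intervalIntegral_add_eq 0 (0 - s)
    rw [zero_add, sub_add_eq_add_sub, zero_add, ← intervalIntegral.integral_comp_sub_right] at this
    rw [this, abs_sub_comm, ← integral_floor_eq_period hw]
    refine intervalIntegral.integral_congr fun x _ => ?_
    simp only [hf, Set.indicator_apply, Set.mem_ofPred_eq, Pi.one_apply]
    rw [add_sub_cancel, add_sub_left_comm]
  have h2 : ∫ b in (0 : ℝ)..N * w, f b = N * max 0 (w - |s - t|) := by
    have := hper.intervalIntegral_add_zsmul_eq N 0 hint
    simpa [h1] using this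
  rw [measureReal_def, cond_apply measurableSet_Icc, ENNReal.toReal_mul, ENNReal.toReal_inv,
    Real.volume_Icc, sub_zero, ENNReal.toReal_ofReal hNw.le]
  rw [intervalIntegral.integral_of_le hNw.le, ← integral_Icc_eq_integral_Ioc,
    integral_indicator_one hm, measureReal_restrict_apply hm, Set.inter_comm] at h2
  rw [← measureReal_def, h2, mul_inv, mul_assoc, mul_left_comm w⁻¹, inv_mul_cancel_left₀
    (Nat.cast_ne_zero.2 hN), mul_max_of_nonneg _ _ (inv_pos.2 hw).le, mul_zero, mul_sub,
    inv_mul_cancel₀ hw.ne', div_eq_inv_mul]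

/-! ### Collision probabilities of the hash functions -/

theorem prod_real_eq_integral {α β : Type*} [MeasurableSpace α] [MeasurableSpace β]
    {μ : Measure α} {ν : Measure β} [IsFiniteMeasure μ] [IsFiniteMeasure ν] {s : Set (α × β)}
    (hs : MeasurableSet s) : (μ.prod ν).real s = ∫ a, ν.real (Prod.mk a ⁻¹' s) ∂μ := by
  rw [measureReal_def, Measure.prod_apply hs, ← integral_toReal
    (measurable_measure_prodMk_left hs).aemeasurable (.of_forall fun a => measure_lt_top _ _)]
  rfl

theorem paramLaw_real_floor_eq {d : ℕ} {p : ℝ} {μ : Measure ℝ} (hμ : IsPStable p μ) {w : ℝ}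
    (hw : 0 < w) {N : ℕ} (hN : N ≠ 0) (W u v : Fin d → ℝ) :
    (paramLaw d μ (N * w)).real
        {ω | ⌊(ω.1 ⬝ᵥ (W * u) + ω.2) / w⌋ = ⌊(ω.1 ⬝ᵥ (W * v) + ω.2) / w⌋} =
      ∫ x, max 0 (1 - |weightedLpDist p W u v * x| / w) ∂μ := by
  have := hμ.isProbabilityMeasure
  have hdot : ∀ z : Fin d → ℝ, Measurable fun a : Fin d → ℝ => a ⬝ᵥ z := fun z => by
    simp only [dotProduct]; fun_prop
  have hdot' : ∀ z : Fin d → ℝ, Measurable fun ω : (Fin d → ℝ) × ℝ => (ω.1 ⬝ᵥ z + ω.2) / w :=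
    fun z => (((hdot z).comp measurable_fst).add measurable_snd).div_const w
  rw [paramLaw, prod_real_eq_integral (measurableSet_floor_eq (hdot' _) (hdot' _))]
  simp only [Set.preimage_ofPred_eq]
  simp_rw [cond_real_floor_eq hw hN]
  have hcont : Continuous fun x : ℝ => max 0 (1 - |x| / w) := by fun_prop
  -- Stability with coefficients `W * u - W * v`: the scale factor is exactly the weighted distance.
  have hstable := congrArg (fun ν => ∫ x, max 0 (1 - |x| / w) ∂ν)
    (hμ.stable d (fun i => (W * u) i - (W * v) i))
  rw [integral_map (Measurable.aemeasurable (by fun_prop)) hcont.aestronglyMeasurable,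
    integral_map (Measurable.aemeasurable (by fun_prop)) hcont.aestronglyMeasurable] at hstable
  rw [weightedLpDist, lpDist, ← hstable]
  refine integral_congr_ae (.of_forall fun a => ?_)
  simp only [dotProduct, ← Finset.sum_sub_distrib]
  congr! 5 with i
  ring

theorem weightedLpDist_nonneg {d : ℕ} (p : ℝ) (W u v : Fin d → ℝ) :
    0 ≤ weightedLpDist p W u v :=
  Real.rpow_nonneg (Finset.sum_nonneg fun _ _ => Real.rpow_nonneg (abs_nonneg _) _) _

theorem levelHash_natCast {d : ℕ} (W : Fin d → ℝ) (w : ℝ) (l : ℕ) (ω : (Fin d → ℝ) × ℝ)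
    (u : Fin d → ℝ) : levelHash W w l ω u = ⌊(ω.1 ⬝ᵥ (W * u) + ω.2) / (w * l)⌋ := by
  rw [levelHash, weightedHash, ← div_div, Int.floor_div_natCast, Int.floor_div_natCast,
    Int.floor_intCast]

/-- The shift interval is `N` periods of width `w * l`, and the kernel is unchanged when distance
and width are both scaled by `l`. `collisionProb` is rewritten only at `x, y > 0`; the actual
distance, possibly 0, enters through the kernel. -/
theorem isSensitive_levelHash {d : ℕ} {p : ℝ} (hp : 0 < p) {μ : Measure ℝ}
    (hμ : IsPStable p μ) {w : ℝ} (hw : 0 < w) (W : Fin d → ℝ) {N l : ℕ} (hN : N ≠ 0) (hl : l ≠ 0)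
    {x y : ℝ} (hx : 0 < x) (hy : 0 < y) :
    IsSensitive (weightedLpDist p W) (paramLaw d μ ((N * l : ℕ) * w)) (levelHash W w l)
      (x * l) (y * l) (collisionProb μ w x) (collisionProb μ w y) := by
  have := hμ.isProbabilityMeasure
  have hl0 : (0 : ℝ) < l := by positivity
  have hscale : ∀ r : ℝ, ∫ a, max 0 (1 - |r * a| / w) ∂μ =
      ∫ a, max 0 (1 - |(r * l) * a| / (w * l)) ∂μ := fun r => by
    refine integral_congr_ae (.of_forall fun a => ?_)
    simp only
    rw [mul_right_comm, abs_mul _ (l : ℝ), abs_of_pos hl0, mul_div_mul_right _ _ hl0.ne']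
  have hac := hμ.absolutelyContinuous hp
  intro u v
  rw [show ((N * l : ℕ) : ℝ) * w = N * (w * l) by push_cast; ring]
  simp only [levelHash_natCast, distBall, Set.mem_ofPred_eq, not_le]
  rw [paramLaw_real_floor_eq hμ (by positivity) hN, collisionProb_eq_integral hac hw hx,
    collisionProb_eq_integral hac hw hy, hscale, hscale]
  exact ⟨fun h => integral_triangle_anti (by positivity) (weightedLpDist_nonneg _ _ _ _) h,
    fun h => integral_triangle_anti (by positivity) (by positivity) h.le⟩

theorem levelCount_mono {c : ℕ} (hc : 2 ≤ c) {s t : ℝ} (hs : 0 < s) (hst : s ≤ t) :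
    levelCount c s ≤ levelCount c t :=
  Nat.ceil_mono (Real.logb_le_logb_of_le (by exact_mod_cast hc) hs hst)

end WeightedLSH

theorem lemma1 (d : ℕ) (p : ℝ) (hp₀ : 0 < p) (hp₂ : p ≤ 2)
    (μ : Measure ℝ) (hμ : WeightedLSH.IsPStable p μ)
    (w : ℝ) (hw : 0 < w)
    (W : Fin d → ℝ) (hW : ∀ i, 0 < W i)
    (c : ℕ) (hc : 2 ≤ c)
    (rmin rmax : ℝ) (hrmin : 0 < rmin) (hrmax : rmin ≤ rmax)
    (ρ : ℝ) (hρ : rmax / rmin ≤ ρ)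
    (x y : ℝ) (hx : 0 < x) (hxy : x < y) :
    WeightedLSH.IsSensitive (WeightedLSH.weightedLpDist p W)
        (WeightedLSH.paramLaw d μ ((c : ℝ) ^ WeightedLSH.levelCount c ρ * w))
        (WeightedLSH.weightedHash W w)
        x y (WeightedLSH.collisionProb μ w x) (WeightedLSH.collisionProb μ w y) ∧
      ∀ j : ℕ, 1 ≤ j → j ≤ WeightedLSH.levelCount c (rmax / rmin) →
        WeightedLSH.IsSensitive (WeightedLSH.weightedLpDist p W)
          (WeightedLSH.paramLaw d μ ((c : ℝ) ^ WeightedLSH.levelCount c ρ * w))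
          (WeightedLSH.levelHash W w ((c : ℝ) ^ j))
          (x * (c : ℝ) ^ j) (y * (c : ℝ) ^ j)
          (WeightedLSH.collisionProb μ w x) (WeightedLSH.collisionProb μ w y) := by

  have hc0 : c ≠ 0 := by omega
  -- Including `j = 0` covers `h` itself, as level 1. The bound on `j` makes `c ^ (levelCount c ρ -
  -- j)` a whole number of periods.
  have hsens : ∀ j ≤ WeightedLSH.levelCount c ρ,
      WeightedLSH.IsSensitive (WeightedLSH.weightedLpDist p W)
        (WeightedLSH.paramLaw d μ ((c : ℝ) ^ WeightedLSH.levelCount c ρ * w))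
        (WeightedLSH.levelHash W w ((c : ℝ) ^ j)) (x * (c : ℝ) ^ j) (y * (c : ℝ) ^ j)
        (WeightedLSH.collisionProb μ w x) (WeightedLSH.collisionProb μ w y) := fun j hj => by
    have h := WeightedLSH.isSensitive_levelHash hp₀ hμ hw W
      (pow_ne_zero (WeightedLSH.levelCount c ρ - j) hc0) (pow_ne_zero j hc0) hx (hx.trans hxy)
    rw [← pow_add, Nat.sub_add_cancel hj] at h
    exact_mod_cast h
  constructor
  · have h0 : WeightedLSH.levelHash W w 1 = WeightedLSH.weightedHash W w := by
      funext ω u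
      rw [WeightedLSH.levelHash, div_one, Int.floor_intCast]
    simpa [h0] using hsens 0 (Nat.zero_le _)
  · exact fun j _ hj => hsens j (hj.trans
      (WeightedLSH.levelCount_mono hc (div_pos (hrmin.trans_le hrmax) hrmin) hρ))
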